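/- Circuit model (indivisible model). A circuit is acyclic and has two disjoint sorts of wires: bit wires, and payload wires, each carrying a $w$-bit string. It consists of generalized boolean gates, each computing an arbitrary truth table from at most $3$ input bit wires to at most $3$ output bit wires, and of $w$-selector gates, which on a bit $b$ and two payloads $m_0,m_1$ output $m_b$. Reverse selector gates, which on a bit $b$ and a payload $m$ output $(m,0^w)$ if $b=0$ and $(0^w,m)$ if $b=1$, are allowed as well and are counted as selector gates. A wire may be fed into any number of gates. Thus boolean gates never read payloads; payloads are only moved by (reverse) selector gates. Loose swapper. Let $n,w\ge 0$ be integers. The input is an array of $n$ elements, each consisting of a $w$-bit payload and a label in $\{\mathtt{blue},\mathtt{red},\bot\}$ encoded by two bits: the first bit says whether the element is colored (label $\neq\bot$), and the second picks the color if it is colored. An array $\mathbf O$ is a *legal swap* of an array $\mathbf I$ if there are pairs of indices $(i_1,j_1),\dots,(i_\ell,j_\ell)$, all $2\ell$ indices being distinct, such that for each $k$ the elements $\mathbf I[i_k]$ and $\mathbf I[j_k]$ are colored with opposite colors, and $\mathbf O$ is obtained from $\mathbf I$ by swapping $\mathbf I[i_k]$ with $\mathbf I[j_k]$ for every $k$ and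 relabeling all swapped elements with $\bot$. A circuit *realizes an $(n,w)$-loose swapper* if, on every input array $\mathbf I$ in which the number of $\mathtt{red}$ elements equals the number of $\mathtt{blue}$ elements, it outputs a legal swap of $\mathbf I$ in which at most $n/128$ elements are colored. Theorem. There are constants $C_1,C_2$ such that for all $n$ and $w$ there exists a circuit in the indivisible model with at most $C_1 n$ generalized boolean gates and at most $C_2 n$ $w$-selector gates that realizes an $(n,w)$-loose swapper. -/

import Mathlib

/-- A circuit in the indivisible model, given as a list of gates in topological order.
There are two disjoint sorts of wires: bit wires, indexed by `β`, and payload wires, indexed by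
`π`, each carrying a `w`-bit string. Every gate adds its output wires to those
already available; a wire may be used any number of times. Boolean gates read and write bit wires
only, so that payloads can only be moved, by selector and reverse selector gates.
`Bout` and `Pout` index the bits and the payloads that the circuit outputs. -/
inductive Circuit (Bout Pout : Type) : Type → Type → Type 1
  /-- No more gates: choose the wire on which each output bit and each output payload is read. -/
  | output {β π : Type} (bit : Bout → β) (pay : Pout → π) : Circuit Bout Pout β π
  /-- A generalized boolean gate: an arbitrary truth table from `a ≤ 3` input bits
  to `c ≤ 3` output bits. -/
  | bool {β π : Type} (a c : ℕ) (ha : a ≤ 3) (hc : c ≤ 3) (ins : Fin a → β)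
      (table : (Fin a → Bool) → (Fin c → Bool)) (rest : Circuit Bout Pout (β ⊕ Fin c) π) :
      Circuit Bout Pout β π
  /-- A selector gate: outputs the payload on `m₀` if the bit on `b` is `0`, else that on `m₁`. -/
  | selector {β π : Type} (b : β) (m₀ m₁ : π) (rest : Circuit Bout Pout β (π ⊕ Fin 1)) :
      Circuit Bout Pout β π
  /-- A reverse selector gate: outputs `(m, 0)` if the bit on `b` is `0`, and `(0, m)` if it is
  `1`, where `m` is the payload on the given wire and `0` the all-zero string. -/
  | reverseSelector {β π : Type} (b : β) (m : π) (rest : Circuit Bout Pout β (π ⊕ Fin 2)) :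
      Circuit Bout Pout β π

namespace Circuit

variable {Bout Pout : Type}

/-- The output bits and output payloads of a circuit, from the values on the available wires. -/
def eval {w : ℕ} : {β π : Type} → Circuit Bout Pout β π → (β → Bool) → (π → BitVec w) →
    (Bout → Bool) × (Pout → BitVec w)
  | _, _, output bit pay, x, y => (fun o => x (bit o), fun o => y (pay o))
  | _, _, bool _ _ _ _ ins table rest, x, y =>
      rest.eval (Sum.elim x (table fun i => x (ins i))) y
  | _, _, selector b m₀ m₁ rest, x, y =>
      rest.eval x (Sum.elim y fun _ => if x b then y m₁ else y m₀)
  | _, _, reverseSelector b m rest, x, y =>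
      rest.eval x (Sum.elim y (if x b then ![0, y m] else ![y m, 0]))

/-- The number of generalized boolean gates. -/
def numBool : {β π : Type} → Circuit Bout Pout β π → ℕ
  | _, _, output _ _ => 0
  | _, _, bool _ _ _ _ _ _ rest => rest.numBool + 1
  | _, _, selector _ _ _ rest => rest.numBool
  | _, _, reverseSelector _ _ rest => rest.numBool

/-- The number of selector gates; reverse selector gates are counted as well. -/
def numSelector : {β π : Type} → Circuit Bout Pout β π → ℕ
  | _, _, output _ _ => 0
  | _, _, bool _ _ _ _ _ _ rest => rest.numSelector
  | _, _, selector _ _ _ rest => rest.numSelector + 1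
  | _, _, reverseSelector _ _ rest => rest.numSelector + 1

end Circuit

/-- The mark of an element. -/
inductive Label
  | uncolored
  | blue
  | red
  deriving DecidableEq

/-- The label encoded by two bits: the first says whether the element is colored, and, if it is,
the second picks the color. -/
def Label.ofBits : Bool → Bool → Label
  | false, _ => uncolored
  | true, false => blue
  | true, true => red

/-- An element: a label together with a `w`-bit payload string. -/
structure Element (w : ℕ) where
  label : Label
  payload : BitVec w

/-- Two labels are colored and have opposite colors. -/
def Label.Opposite (a b : Label) : Prop :=
  (a = blue ∧ b = red) ∨ (a = red ∧ b = blue)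

/-- `O` is obtained from `I` by choosing pairs `(i 0, j 0), …, (i (l - 1), j (l - 1))` of indices,
all distinct, such that the two elements of each pair are colored with opposite colors, swapping
the two elements of each pair, and uncoloring all swapped elements. -/
def LegalSwap {n w : ℕ} (I O : Fin n → Element w) : Prop :=
  ∃ (l : ℕ) (i j : Fin l → Fin n),
    Function.Injective (Sum.elim i j) ∧
    (∀ k, Label.Opposite (I (i k)).label (I (j k)).label) ∧
    (∀ k, O (i k) = ⟨Label.uncolored, (I (j k)).payload⟩) ∧
    (∀ k, O (j k) = ⟨Label.uncolored, (I (i k)).payload⟩) ∧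
    (∀ m, (∀ k, m ≠ i k ∧ m ≠ j k) → O m = I m)

/-- The number of elements of the array with a given label. -/
def numLabel {n w : ℕ} (c : Label) (A : Fin n → Element w) : ℕ :=
  (Finset.univ.filter fun m => (A m).label = c).card

/-- The number of colored elements of the array. -/
def numColored {n w : ℕ} (A : Fin n → Element w) : ℕ :=
  (Finset.univ.filter fun m => (A m).label ≠ Label.uncolored).card

/-- The array of `n` elements given by `2 n` label bits, bits `(m, 0)` and `(m, 1)` being the first
and the second label bit of the element `m`, and `n` payloads. -/
def arrayOf {n w : ℕ} (v : (Fin n × Fin 2 → Bool) × (Fin n → BitVec w)) : Fin n → Element w :=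
  fun m => ⟨Label.ofBits (v.1 (m, 0)) (v.1 (m, 1)), v.2 m⟩

/-- The circuit realizes an `(n, w)`-loose swapper: on every input array with as many red as
blue elements, it outputs a legal swap of it with at most `n / 128` colored elements. -/
def IsLooseSwapper (n w : ℕ)
    (Γ : Circuit (Fin n × Fin 2) (Fin n) (Fin n × Fin 2) (Fin n)) : Prop :=
  ∀ (x : Fin n × Fin 2 → Bool) (y : Fin n → BitVec w),
    numLabel Label.red (arrayOf (x, y)) = numLabel Label.blue (arrayOf (x, y)) →
      LegalSwap (arrayOf (x, y)) (arrayOf (Γ.eval x y)) ∧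
      (numColored (arrayOf (Γ.eval x y)) : ℝ) ≤ (n : ℝ) / 128

/-!
Fix a list of linearly many pairs of positions containing a pair in `A × B` whenever `A` and `B`
are both large; random pairs have this property because there are only `4 ^ n` choices of `A` and
`B`. Go through the list once, swapping and uncoloring the two elements of a pair whenever their
colors are opposite. Labels only ever change to `uncolored`, so in the final array no pair of the
list has opposite colors, and hence the red and the blue positions are not both large. Each swap
removes one red and one blue element, so the two numbers still differ by as much as they did in the
input. Executing one pair takes two boolean gates and two selector gates.
-/

section JoiningLists

open Finset

theorem exists_forall_exists_mem_of_sum_card_compl_pow_lt {α ι κ : Type*} [Fintype α]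
    [DecidableEq α] [Fintype κ] {S : Finset ι} {T : ι → Finset α}
    (h : ∑ s ∈ S, #(T s)ᶜ ^ Fintype.card κ < Fintype.card α ^ Fintype.card κ) :
    ∃ f : κ → α, ∀ s ∈ S, ∃ k, f k ∈ T s := by
  classical
  by_contra! hmiss
  have hcover : univ ⊆ S.biUnion fun s => Fintype.piFinset fun _ : κ => (T s)ᶜ := by
    intro f _
    obtain ⟨s, hs, hf⟩ := hmiss f
    exact mem_biUnion.2 ⟨s, hs, Fintype.mem_piFinset.2 fun k => mem_compl.2 (hf k)⟩
  refine h.not_ge ?_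
  calc Fintype.card α ^ Fintype.card κ = #(univ : Finset (κ → α)) := by
        rw [card_univ, Fintype.card_fun]
    _ ≤ #(S.biUnion fun s => Fintype.piFinset fun _ : κ => (T s)ᶜ) := card_le_card hcover
    _ ≤ ∑ s ∈ S, #(Fintype.piFinset fun _ : κ => (T s)ᶜ) := card_biUnion_le
    _ = ∑ s ∈ S, #(T s)ᶜ ^ Fintype.card κ := by
        simp only [Fintype.card_piFinset, prod_const, card_univ]

variable {V : Type*} [Fintype V]

/-- The pairs of `L`, viewed as edges from left to right, join any two sets of vertices that both
contain more than a `δ` fraction of all vertices. The inequalities are strict so that no exception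
is needed for an empty vertex set. -/
def JoinsLargeSets (δ : ℝ) (L : List (V × V)) : Prop :=
  ∀ A B : Finset V, δ * Fintype.card V < #A → δ * Fintype.card V < #B → ∃ e ∈ L, e.1 ∈ A ∧ e.2 ∈ B

theorem card_compl_product_le [DecidableEq V] {δ : ℝ} (hδ : 0 ≤ δ) {A B : Finset V}
    (hA : δ * Fintype.card V ≤ #A) (hB : δ * Fintype.card V ≤ #B) :
    (#(A ×ˢ B)ᶜ : ℝ) ≤ Real.exp (-δ ^ 2) * (Fintype.card V : ℝ) ^ 2 := by
  have hcard : (#(A ×ˢ B)ᶜ : ℝ) = (Fintype.card V : ℝ) ^ 2 - #A * #B := by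
    rw [card_compl, Nat.cast_sub (card_le_univ _), card_product, Fintype.card_prod]
    push_cast
    ring
  calc (#(A ×ˢ B)ᶜ : ℝ) = (Fintype.card V : ℝ) ^ 2 - #A * #B := hcard
    _ ≤ (Fintype.card V : ℝ) ^ 2 - (δ * Fintype.card V) * (δ * Fintype.card V) := by gcongr
    _ = (1 - δ ^ 2) * (Fintype.card V : ℝ) ^ 2 := by ring
    _ ≤ Real.exp (-δ ^ 2) * (Fintype.card V : ℝ) ^ 2 := by
        gcongr
        exact Real.one_sub_le_exp_neg _

theorem four_pow_lt_exp_two_mul {n : ℕ} (hn : n ≠ 0) : (4 : ℝ) ^ n < Real.exp (2 * n) := by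
  have h : (4 : ℝ) < Real.exp 2 := by
    have h2 : (2 : ℝ) < Real.exp 1 := by
      rw [← one_add_one_eq_two]
      exact Real.add_one_lt_exp one_ne_zero
    calc (4 : ℝ) = 2 ^ 2 := by norm_num
      _ < Real.exp 1 ^ 2 := by gcongr
      _ = Real.exp 2 := by rw [← Real.exp_nat_mul]; norm_num
  calc (4 : ℝ) ^ n < Real.exp 2 ^ n := by gcongr
    _ = Real.exp (2 * n) := by rw [← Real.exp_nat_mul, mul_comm]

theorem sum_card_compl_product_pow_lt [Nonempty V] [DecidableEq V] {δ : ℝ} (hδ : 0 ≤ δ) {m : ℕ}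
    (hm : 2 * Fintype.card V ≤ δ ^ 2 * m) {S : Finset (Finset V × Finset V)}
    (hS : ∀ s ∈ S, δ * Fintype.card V ≤ #s.1 ∧ δ * Fintype.card V ≤ #s.2) :
    ∑ s ∈ S, (#(s.1 ×ˢ s.2)ᶜ : ℝ) ^ m < ((Fintype.card V : ℝ) ^ 2) ^ m := by
  have hn : 0 < Fintype.card V := Fintype.card_pos
  set n := Fintype.card V
  have hcard : (#S : ℝ) ≤ 4 ^ n := by
    have h : #S ≤ 4 ^ n := (card_le_univ S).trans_eq (by simp [n, ← mul_pow])
    exact_mod_cast h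
  have hmiss : ∀ s ∈ S, (#(s.1 ×ˢ s.2)ᶜ : ℝ) ^ m ≤ Real.exp (-(2 * n)) * ((n : ℝ) ^ 2) ^ m := by
    intro s hs
    calc (#(s.1 ×ˢ s.2)ᶜ : ℝ) ^ m ≤ (Real.exp (-δ ^ 2) * (n : ℝ) ^ 2) ^ m := by
          gcongr
          exact card_compl_product_le hδ (hS s hs).1 (hS s hs).2
      _ = Real.exp (-(δ ^ 2 * m)) * ((n : ℝ) ^ 2) ^ m := by
          rw [mul_pow, ← Real.exp_nat_mul]
          ring_nf
      _ ≤ Real.exp (-(2 * n)) * ((n : ℝ) ^ 2) ^ m := by gcongr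
  calc ∑ s ∈ S, (#(s.1 ×ˢ s.2)ᶜ : ℝ) ^ m
      ≤ #S * (Real.exp (-(2 * n)) * ((n : ℝ) ^ 2) ^ m) := by
        simpa only [nsmul_eq_mul] using sum_le_card_nsmul S _ _ hmiss
    _ ≤ 4 ^ n * (Real.exp (-(2 * n)) * ((n : ℝ) ^ 2) ^ m) := by gcongr
    _ < Real.exp (2 * n) * (Real.exp (-(2 * n)) * ((n : ℝ) ^ 2) ^ m) := by
        gcongr
        exact four_pow_lt_exp_two_mul hn.ne'
    _ = ((n : ℝ) ^ 2) ^ m := by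
        rw [← mul_assoc, ← Real.exp_add, add_neg_cancel, Real.exp_zero, one_mul]

theorem exists_joinsLargeSets (V : Type*) [Fintype V] {δ : ℝ} (hδ : 0 < δ) :
    ∃ L : List (V × V), L.length = ⌈2 / δ ^ 2⌉₊ * Fintype.card V ∧ JoinsLargeSets δ L := by
  classical
  rcases isEmpty_or_nonempty V with hV | hV
  · exact ⟨[], by simp, fun A B hA => by simp [A.eq_empty_of_isEmpty] at hA⟩
  set m := ⌈2 / δ ^ 2⌉₊ * Fintype.card V with hm_def
  have hm : 2 * Fintype.card V ≤ δ ^ 2 * m := by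
    have hceil := (div_le_iff₀' (pow_pos hδ 2)).1 (Nat.le_ceil (2 / δ ^ 2))
    rw [hm_def, Nat.cast_mul, ← mul_assoc]
    gcongr
  let S : Finset (Finset V × Finset V) :=
    {s | δ * Fintype.card V < #s.1 ∧ δ * Fintype.card V < #s.2}
  have hlt := sum_card_compl_product_pow_lt hδ.le hm (S := S) fun s hs =>
    (mem_filter.1 hs).2.imp le_of_lt le_of_lt
  obtain ⟨f, hf⟩ := exists_forall_exists_mem_of_sum_card_compl_pow_lt (κ := Fin m) (S := S)
    (T := fun s => s.1 ×ˢ s.2) (by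
      rw [Fintype.card_fin, Fintype.card_prod, ← sq]
      exact_mod_cast hlt)
  refine ⟨List.ofFn f, List.length_ofFn, fun A B hA hB => ?_⟩
  obtain ⟨k, hk⟩ := hf (A, B) (mem_filter.2 ⟨mem_univ _, hA, hB⟩)
  exact ⟨f k, List.mem_ofFn.2 ⟨k, rfl⟩, mem_product.1 hk⟩

end JoiningLists

namespace Label

instance instDecidableOpposite (a b : Label) : Decidable (a.Opposite b) :=
  inferInstanceAs (Decidable (_ ∨ _))

theorem Opposite.left_ne_uncolored {a b : Label} (h : a.Opposite b) : a ≠ uncolored := by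
  rcases h with ⟨rfl, rfl⟩ | ⟨rfl, rfl⟩ <;> decide

theorem Opposite.right_ne_uncolored {a b : Label} (h : a.Opposite b) : b ≠ uncolored := by
  rcases h with ⟨rfl, rfl⟩ | ⟨rfl, rfl⟩ <;> decide

theorem Opposite.ne {a b : Label} (h : a.Opposite b) : a ≠ b := by
  rcases h with ⟨rfl, rfl⟩ | ⟨rfl, rfl⟩ <;> decide

/-- The contribution of an element to the number of red minus the number of blue elements. -/
def charge : Label → ℤ
  | uncolored => 0
  | blue => -1
  | red => 1

theorem Opposite.charge_add_charge {a b : Label} (h : a.Opposite b) :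
    a.charge + b.charge = 0 := by
  rcases h with ⟨rfl, rfl⟩ | ⟨rfl, rfl⟩ <;> rfl

end Label

section Arrays

variable {n w : ℕ} {I O : Fin n → Element w}

theorem numColored_eq_numLabel_red_add_numLabel_blue (A : Fin n → Element w) :
    numColored A = numLabel .red A + numLabel .blue A := by
  simp only [numColored, numLabel, Finset.card_filter, ← Finset.sum_add_distrib]
  refine Finset.sum_congr rfl fun m _ => ?_
  cases (A m).label <;> rfl

theorem numLabel_red_sub_numLabel_blue_eq_sum_charge (A : Fin n → Element w) :
    (numLabel .red A - numLabel .blue A : ℤ) = ∑ m, (A m).label.charge := by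
  simp only [numLabel, Finset.card_filter, Nat.cast_sum, ← Finset.sum_sub_distrib]
  refine Finset.sum_congr rfl fun m _ => ?_
  cases (A m).label <;> rfl

theorem LegalSwap.refl (I : Fin n → Element w) : LegalSwap I I :=
  ⟨0, Fin.elim0, Fin.elim0, Function.injective_of_subsingleton _, fun k => k.elim0,
    fun k => k.elim0, fun k => k.elim0, fun _ _ => rfl⟩

theorem LegalSwap.sum_charge (h : LegalSwap I O) :
    ∑ m, (O m).label.charge = ∑ m, (I m).label.charge := by
  obtain ⟨l, i, j, hinj, hopp, hi, hj, hrest⟩ := h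
  have hswapped : ∑ k, ((I (Sum.elim i j k)).label.charge - (O (Sum.elim i j k)).label.charge) =
      ∑ m, ((I m).label.charge - (O m).label.charge) := by
    refine Fintype.sum_of_injective _ hinj _ _ (fun m hm => ?_) fun _ => rfl
    rw [hrest m fun k => ⟨fun h => hm ⟨.inl k, h.symm⟩, fun h => hm ⟨.inr k, h.symm⟩⟩, sub_self]
  have hzero : ∑ m, ((I m).label.charge - (O m).label.charge) = 0 := by
    rw [← hswapped, Fintype.sum_sum_type, ← Finset.sum_add_distrib]
    refine Finset.sum_eq_zero fun k _ => ?_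
    simpa [hi, hj, Label.charge] using (hopp k).charge_add_charge
  rw [Finset.sum_sub_distrib, sub_eq_zero] at hzero
  exact hzero.symm

theorem LegalSwap.numLabel_red_sub_numLabel_blue (h : LegalSwap I O) :
    (numLabel .red O - numLabel .blue O : ℤ) = numLabel .red I - numLabel .blue I := by
  simp only [numLabel_red_sub_numLabel_blue_eq_sum_charge, h.sum_charge]

theorem LegalSwap.label_eq_of_ne_uncolored (h : LegalSwap I O) {m : Fin n}
    (hm : (O m).label ≠ .uncolored) : (O m).label = (I m).label := by
  obtain ⟨l, i, j, -, -, hi, hj, hrest⟩ := h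
  rw [hrest m fun k => ⟨?_, ?_⟩]
  · rintro rfl
    exact hm (by rw [hi])
  · rintro rfl
    exact hm (by rw [hj])

theorem LegalSwap.opposite_of_opposite (h : LegalSwap I O) {a b : Fin n}
    (hab : (O a).label.Opposite (O b).label) : (I a).label.Opposite (I b).label := by
  rwa [h.label_eq_of_ne_uncolored hab.left_ne_uncolored,
    h.label_eq_of_ne_uncolored hab.right_ne_uncolored] at hab

/-- The array `A` with the elements at the positions `e.1` and `e.2` swapped and uncolored if they
have opposite colors, and `A` itself otherwise. -/
def swapIfOpposite (A : Fin n → Element w) (e : Fin n × Fin n) : Fin n → Element w :=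
  if (A e.1).label.Opposite (A e.2).label then
    Function.update (Function.update A e.1 ⟨.uncolored, (A e.2).payload⟩) e.2
      ⟨.uncolored, (A e.1).payload⟩
  else A

theorem not_opposite_swapIfOpposite (A : Fin n → Element w) (e : Fin n × Fin n) :
    ¬ (swapIfOpposite A e e.1).label.Opposite (swapIfOpposite A e e.2).label := by
  unfold swapIfOpposite
  split_ifs with h
  · exact fun hopp => hopp.right_ne_uncolored (by rw [Function.update_self])
  · exact h

theorem LegalSwap.swapIfOpposite_right (h : LegalSwap I O) (e : Fin n × Fin n) :
    LegalSwap I (swapIfOpposite O e) := by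
  obtain ⟨a, b⟩ := e
  unfold swapIfOpposite
  split_ifs with hab
  case neg => exact h
  obtain ⟨l, i, j, hinj, hopp, hi, hj, hrest⟩ := h
  have ne_of_colored {m : Fin n} (hm : (O m).label ≠ .uncolored) (k : Fin l) :
      m ≠ i k ∧ m ≠ j k :=
    ⟨fun h => hm (by rw [h, hi]), fun h => hm (by rw [h, hj])⟩
  have ha := ne_of_colored hab.left_ne_uncolored
  have hb := ne_of_colored hab.right_ne_uncolored
  have hne : a ≠ b := fun h => hab.ne (by rw [h])
  simp only [hrest a ha, hrest b hb] at hab ⊢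
  refine ⟨l + 1, Fin.cons a i, Fin.cons b j, ?_, ?_, ?_, ?_, ?_⟩
  · rw [Sum.elim_injective] at hinj ⊢
    obtain ⟨hi_inj, hj_inj, hij⟩ := hinj
    refine ⟨Fin.cons_injective_iff.2 ⟨?_, hi_inj⟩, Fin.cons_injective_iff.2 ⟨?_, hj_inj⟩, ?_⟩
    · exact fun ⟨k, hk⟩ => (ha k).1 hk.symm
    · exact fun ⟨k, hk⟩ => (hb k).2 hk.symm
    · simpa [Fin.forall_fin_succ, hne, hij] using
        ⟨fun k => (ha k).2, fun k => (hb k).1.symm⟩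
  · exact Fin.cases hab hopp
  · exact Fin.cases (by simp [hne]) fun k => by simp [(ha k).1.symm, (hb k).1.symm, hi]
  · exact Fin.cases (by simp) fun k => by simp [(ha k).2.symm, (hb k).2.symm, hj]
  · intro m hm
    simp only [Fin.forall_fin_succ, Fin.cons_zero, Fin.cons_succ] at hm
    obtain ⟨⟨hma, hmb⟩, hm⟩ := hm
    rw [Function.update_of_ne hmb, Function.update_of_ne hma]
    exact hrest m hm

theorem legalSwap_foldl_swapIfOpposite (L : List (Fin n × Fin n)) (I : Fin n → Element w) :
    LegalSwap I (L.foldl swapIfOpposite I) :=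
  L.foldlRecOn swapIfOpposite (LegalSwap.refl I) fun _ h e _ => h.swapIfOpposite_right e

theorem not_opposite_foldl_swapIfOpposite {L : List (Fin n × Fin n)} {e : Fin n × Fin n}
    (he : e ∈ L) (A : Fin n → Element w) :
    ¬ (L.foldl swapIfOpposite A e.1).label.Opposite (L.foldl swapIfOpposite A e.2).label := by
  obtain ⟨L₁, L₂, rfl⟩ := List.append_of_mem he
  rw [List.foldl_append, List.foldl_cons]
  exact fun h => not_opposite_swapIfOpposite _ e
    ((legalSwap_foldl_swapIfOpposite L₂ _).opposite_of_opposite h)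

theorem JoinsLargeSets.min_numLabel_foldl_le {δ : ℝ} {L : List (Fin n × Fin n)}
    (hL : JoinsLargeSets δ L) (A : Fin n → Element w) :
    (min (numLabel .red (L.foldl swapIfOpposite A))
      (numLabel .blue (L.foldl swapIfOpposite A)) : ℝ) ≤ δ * n := by
  by_contra! hlarge
  obtain ⟨hred, hblue⟩ := lt_min_iff.1 hlarge
  simp only [JoinsLargeSets, Fintype.card_fin] at hL
  obtain ⟨e, he, hr, hb⟩ := hL _ _ hred hblue
  exact not_opposite_foldl_swapIfOpposite he A
    (.inr ⟨(Finset.mem_filter.1 hr).2, (Finset.mem_filter.1 hb).2⟩)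

theorem JoinsLargeSets.numColored_foldl_le {δ : ℝ} {L : List (Fin n × Fin n)}
    (hL : JoinsLargeSets δ L) (A : Fin n → Element w) :
    (numColored (L.foldl swapIfOpposite A) : ℝ) ≤
      2 * δ * n + |(numLabel .red A : ℝ) - numLabel .blue A| := by
  have hmin := hL.min_numLabel_foldl_le A
  have hdiff := (legalSwap_foldl_swapIfOpposite L A).numLabel_red_sub_numLabel_blue
  set O := L.foldl swapIfOpposite A
  have hdiff' : (numLabel .red O - numLabel .blue O : ℝ) = numLabel .red A - numLabel .blue A :=
    mod_cast hdiff
  rw [numColored_eq_numLabel_red_add_numLabel_blue, Nat.cast_add, ← hdiff',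
    ← max_sub_min_eq_abs', ← min_add_max (numLabel .red O : ℝ) (numLabel .blue O)]
  linarith

end Arrays

section SwapCircuit

variable {n w : ℕ}

/-- Whether the elements at the positions `e.1` and `e.2` have opposite colors, computed from the
label bits of the array. -/
def oppositeBit (v : Fin n × Fin 2 → Bool) (e : Fin n × Fin n) : Bool :=
  v (e.1, 0) && (v (e.1, 1) ^^ v (e.2, 1)) && v (e.2, 0)

theorem opposite_arrayOf_iff (v : Fin n × Fin 2 → Bool) (y : Fin n → BitVec w)
    (e : Fin n × Fin n) :
    (arrayOf (v, y) e.1).label.Opposite (arrayOf (v, y) e.2).label ↔ oppositeBit v e = true := by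
  simp only [arrayOf, oppositeBit]
  generalize v (e.1, 0) = c, v (e.1, 1) = d, v (e.2, 0) = c', v (e.2, 1) = d'
  decide +revert

theorem swapIfOpposite_arrayOf (v : Fin n × Fin 2 → Bool) (y : Fin n → BitVec w)
    (e : Fin n × Fin n) :
    swapIfOpposite (arrayOf (v, y)) e = arrayOf
      (Function.update (Function.update v (e.1, 0) (v (e.1, 0) && !oppositeBit v e))
        (e.2, 0) (v (e.2, 0) && !oppositeBit v e),
       Function.update (Function.update y e.1 (if oppositeBit v e then y e.2 else y e.1))
        e.2 (if oppositeBit v e then y e.1 else y e.2)) := by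
  unfold swapIfOpposite
  simp only [opposite_arrayOf_iff]
  split_ifs with h
  · funext m
    rcases eq_or_ne m e.2 with rfl | h₂
    · simp [arrayOf, h, Label.ofBits]
    rcases eq_or_ne m e.1 with rfl | h₁
    · simp [arrayOf, h, h₂, Label.ofBits]
    · simp [arrayOf, h₁, h₂]
  · simp [h]

/-- The circuit that performs `swapIfOpposite` along a list of pairs, where `bit` and `pay` are the
wires that hold the current array. An element is uncolored by clearing its first label bit, so the
second label bits never move. -/
def swapCircuit : List (Fin n × Fin n) → {β π : Type} → (Fin n × Fin 2 → β) → (Fin n → π) →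
    Circuit (Fin n × Fin 2) (Fin n) β π
  | [], _, _, bit, pay => .output bit pay
  | e :: L, _, _, bit, pay =>
    -- `oppositeBit` depends on four bits, one more than a single gate can read.
    .bool 3 1 le_rfl (by norm_num) ![bit (e.1, 0), bit (e.1, 1), bit (e.2, 1)]
      (fun v _ => v 0 && (v 1 ^^ v 2)) <|
    .bool 3 3 le_rfl le_rfl ![.inr 0, .inl (bit (e.1, 0)), .inl (bit (e.2, 0))]
      (fun v => ![v 0 && v 2, v 1 && !(v 0 && v 2), v 2 && !(v 0 && v 2)]) <|
    .selector (.inr 0) (pay e.1) (pay e.2) <|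
    .selector (.inr 0) (.inl (pay e.2)) (.inl (pay e.1)) <|
    swapCircuit L
      (Function.update (Function.update (fun p => .inl (.inl (bit p))) (e.1, 0) (.inr 1))
        (e.2, 0) (.inr 2))
      (Function.update (Function.update (fun m => .inl (.inl (pay m))) e.1 (.inl (.inr 0)))
        e.2 (.inr 0))

theorem numBool_swapCircuit (L : List (Fin n × Fin n)) {β π : Type} (bit : Fin n × Fin 2 → β)
    (pay : Fin n → π) : (swapCircuit L bit pay).numBool = 2 * L.length := by
  induction L generalizing β π with
  | nil => rfl
  | cons e L ih => simp only [swapCircuit, Circuit.numBool, ih, List.length_cons]; ring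

theorem numSelector_swapCircuit (L : List (Fin n × Fin n)) {β π : Type} (bit : Fin n × Fin 2 → β)
    (pay : Fin n → π) : (swapCircuit L bit pay).numSelector = 2 * L.length := by
  induction L generalizing β π with
  | nil => rfl
  | cons e L ih => simp only [swapCircuit, Circuit.numSelector, ih, List.length_cons]; ring

theorem arrayOf_eval_swapCircuit (L : List (Fin n × Fin n)) {β π : Type} (bit : Fin n × Fin 2 → β)
    (pay : Fin n → π) (x : β → Bool) (y : π → BitVec w) :
    arrayOf ((swapCircuit L bit pay).eval x y) =
      L.foldl swapIfOpposite (arrayOf (x ∘ bit, y ∘ pay)) := by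
  induction L generalizing β π with
  | nil => rfl
  | cons e L ih =>
    rw [List.foldl_cons, swapIfOpposite_arrayOf, swapCircuit]
    simp only [Circuit.eval, ih, Function.comp_update]
    rfl

end SwapCircuit

theorem mainTheorem8_general {ε : ℝ} (hε : 0 < ε) :
    ∃ C₁ C₂ : ℕ, ∀ n : ℕ, ∃ Γ : Circuit (Fin n × Fin 2) (Fin n) (Fin n × Fin 2) (Fin n),
      Γ.numBool ≤ C₁ * n ∧ Γ.numSelector ≤ C₂ * n ∧
      ∀ (w : ℕ) (x : Fin n × Fin 2 → Bool) (y : Fin n → BitVec w),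
        LegalSwap (arrayOf (x, y)) (arrayOf (Γ.eval x y)) ∧
        (numColored (arrayOf (Γ.eval x y)) : ℝ) ≤ ε * n +
          |(numLabel .red (arrayOf (x, y)) : ℝ) - numLabel .blue (arrayOf (x, y))| := by
  set D := ⌈2 / (ε / 2) ^ 2⌉₊
  refine ⟨2 * D, 2 * D, fun n => ?_⟩
  obtain ⟨L, hlen, hL⟩ := exists_joinsLargeSets (Fin n) (half_pos hε)
  rw [Fintype.card_fin] at hlen
  refine ⟨swapCircuit L id id, ?_, ?_, fun w x y => ?_⟩
  · rw [numBool_swapCircuit, hlen, mul_assoc]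
  · rw [numSelector_swapCircuit, hlen, mul_assoc]
  · rw [arrayOf_eval_swapCircuit, Function.comp_id, Function.comp_id]
    refine ⟨legalSwap_foldl_swapIfOpposite L _, ?_⟩
    simpa only [mul_div_cancel₀ ε two_ne_zero] using hL.numColored_foldl_le (arrayOf (x, y))

theorem mainTheorem8 :
    ∃ C₁ C₂ : ℕ, ∀ n w : ℕ,
      ∃ Γ : Circuit (Fin n × Fin 2) (Fin n) (Fin n × Fin 2) (Fin n),
        Γ.numBool ≤ C₁ * n ∧ Γ.numSelector ≤ C₂ * n ∧ IsLooseSwapper n w Γ := by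
  obtain ⟨C₁, C₂, h⟩ := mainTheorem8_general (ε := 1 / 128) (by norm_num)
  refine ⟨C₁, C₂, fun n w => (h n).imp fun Γ ⟨hbool, hsel, hΓ⟩ => ⟨hbool, hsel, fun x y hxy => ?_⟩⟩
  simpa [hxy, div_eq_inv_mul] using hΓ w x y
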